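/- **Setting.** Let $\Sigma$ be a finite alphabet. A parity automaton $(Q,\Sigma,\delta,Q_0)$ has a finite state set $Q$, transitions $\delta\subseteq Q\times\Sigma\times Q\times\mathbb N$ (the last component is the color) and initial states $Q_0$. It accepts $w\in\Sigma^\omega$ if $w$ has a run from a state of $Q_0$ along which the lowest color that occurs infinitely often is even. It is a DPA if $Q_0=\{q_0\}$ and for all $q\in Q$, $x\in\Sigma$ there is exactly one $(q,x,q',c)\in\delta$. States $q,q'$ of a DPA $\mathcal A$ are equivalent, $q\sim_{\mathcal A}q'$, if $\mathcal A$ accepts the same words when started in $q$ as when started in $q'$. A DPA is structured if all its states are reachable and equivalent states lie in the same maximal strongly connected component (SCC). **Streamlining.** The streamlined version of a structured DPA has the same states and transitions, with new colors given as follows. Start with $i=0$ and with $\mathcal G$ the graph of the automaton, and repeat until $\mathcal G$ is empty: give color $i$ to all transient transitions of $\mathcal G$ (those that lie on no cycle of $\mathcal G$) and remove them and the transient states from $\mathcal G$; then consider, in each SCC of $\mathcal G$ whose least transition color has the same parity as $i$, the transitions of this least color; if there are any, give them color $i$ and remove them from $\mathcal G$, otherwise increase $i$ by $1$. This process terminates.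 A DPA is streamlined if it is the streamlined version of some structured DPA. **The automata $\mathcal A_i$.** For a streamlined DPA $\mathcal A=(Q,\Sigma,\delta,q_0)$ and $i\in\mathbb N$, let $\mathcal A_i=(Q,\Sigma,\delta_i,\{q_0\})$ be the co-Büchi automaton in which each $(q,x,q',c)\in\delta$ contributes the transition $(q,x,q',2)$ if $c\ge i$, the transition $(q,x,q',1)$ if $c<i$, and the transitions $(q,x,q'',1)$ for all $q''\sim_{\mathcal A}q'$ such that $(q,x,q'',c')\notin\delta$ for all $c'$. **Natural colors.** Let $L\subseteq\Sigma^\omega$. A finite word $u$ is suffix language invariant for $L$ after a finite word $v$ if $\{z\in\Sigma^\omega: vz\in L\}=\{z\in\Sigma^\omega: vuz\in L\}$. A word $w'$ is the result of a suffix language invariant injection of finite words $u_0,u_1,\dots$ into $w=w_0w_1\cdots$ at positions $i_0<i_1<\cdots$ if $w'=w_0\cdots w_{i_0}\,u_0\,w_{i_0+1}\cdots w_{i_1}\,u_1\,w_{i_1+1}\cdots$ and each $u_j$ is suffix language invariant for $L$ after $w_0\cdots w_{i_j}$. By recursion on $i\in\mathbb N$, the word $w$ is at home in color $i$ for $L$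 if there is an infinite set $J\subseteq\mathbb N$ such that every result $w'$ of a suffix language invariant injection into $w$ at the positions $J$ satisfies one of the following: $w'$ is at home in some color smaller than $i$; or $i$ is even and $w,w'\in L$; or $i$ is odd and $w,w'\notin L$. The natural color of $w$ for $L$ is the least color in which $w$ is at home for $L$. **Theorem.** Let $\mathcal A$ be a streamlined DPA. Every word $w\in\Sigma^\omega$ has a natural color for $\mathcal L(\mathcal A)$, and for every $i\in\mathbb N$, the automaton $\mathcal A_i$ accepts $w$ if, and only if, the natural color of $w$ for $\mathcal L(\mathcal A)$ is at least $i$. -/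

import Mathlib

/-! Infinite words over `α` are elements of `Stream' α`; finite words are elements of `List α`;
`u ++ₛ w` is the concatenation of a finite and an infinite word, `w.take n` is the prefix of
length `n` of `w`, and `w.drop n` is `w` without its first `n` letters. -/

/-- Parity automata with transition-based acceptance. -/
structure ParityAutomaton (α : Type*) (Q : Type*) where
  /-- transitions `(q, x, q', c)`: from `q` to `q'` reading `x`, with color `c` -/
  trans : Set (Q × α × Q × ℕ)
  /-- initial states -/
  init : Set Q

namespace ParityAutomaton

variable {α Q : Type*}

/-- `π` is a run of the automaton on `w`, with color sequence `ρ`. -/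
def IsRun (A : ParityAutomaton α Q) (w : Stream' α) (π : ℕ → Q) (ρ : ℕ → ℕ) : Prop :=
  π 0 ∈ A.init ∧ ∀ j, (π j, w.get j, π (j + 1), ρ j) ∈ A.trans

/-- `c` is the lowest color that occurs infinitely often in `ρ`. -/
def IsDominating (ρ : ℕ → ℕ) (c : ℕ) : Prop :=
  IsLeast {c : ℕ | {j | ρ j = c}.Infinite} c

/-- `w` is accepted if it has a run whose dominating color is even. -/
def Accepts (A : ParityAutomaton α Q) (w : Stream' α) : Prop :=
  ∃ π ρ, A.IsRun w π ρ ∧ ∃ c, IsDominating ρ c ∧ Even c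

/-- The set of accepted words. -/
def language (A : ParityAutomaton α Q) : Set (Stream' α) := {w | A.Accepts w}

end ParityAutomaton

/-- Deterministic parity automata. There is exactly one transition for every state and letter,
so a transition is identified with its source state and its letter. -/
structure DPA (α : Type*) (Q : Type*) where
  /-- target state of the transition -/
  next : Q × α → Q
  /-- color of the transition -/
  color : Q × α → ℕ
  /-- initial state -/
  start : Q

namespace DPA

variable {α Q : Type*}

/-- A deterministic parity automaton, seen as a parity automaton. -/
def toParityAutomaton (A : DPA α Q) : ParityAutomaton α Q where
  trans := {(q, x, q', c) | q' = A.next (q, x) ∧ c = A.color (q, x)}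
  init := {A.start}

/-- The language of a deterministic parity automaton. -/
def language (A : DPA α Q) : Set (Stream' α) := A.toParityAutomaton.language

/-- The automaton with the initial state replaced by `q`. -/
def withStart (A : DPA α Q) (q : Q) : DPA α Q := { A with start := q }

/-- Language equivalence of states. -/
def StateEquiv (A : DPA α Q) (q q' : Q) : Prop :=
  (A.withStart q).language = (A.withStart q').language

/-- `q'` can be reached from `q` using only the transitions in `G`. -/
def Reachable (A : DPA α Q) (G : Set (Q × α)) : Q → Q → Prop :=
  Relation.ReflTransGen fun q q' => ∃ x, (q, x) ∈ G ∧ A.next (q, x) = q'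

/-- `q` and `q'` lie in the same maximal strongly connected component of the graph with
transitions `G`. -/
def SameSCC (A : DPA α Q) (G : Set (Q × α)) (q q' : Q) : Prop :=
  A.Reachable G q q' ∧ A.Reachable G q' q

/-- All states are reachable, and equivalent states are in the same maximal strongly connected
component. -/
def IsStructured (A : DPA α Q) : Prop :=
  (∀ q, A.Reachable Set.univ A.start q) ∧
    ∀ q q', A.StateEquiv q q' → A.SameSCC Set.univ q q'

/-- The transitions of `G` that can be taken at most once along a path in `G`. -/
def transient (A : DPA α Q) (G : Set (Q × α)) : Set (Q × α) :=
  {t ∈ G | ¬ A.Reachable G (A.next t) t.1}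

/-- The intermediate states of the streamlining process. Only the transitions of the coloring
graph are recorded: a removed state is transient, so all its transitions are transient and are
removed with it, and states without transitions have no influence on the colors. -/
structure StreamliningState (α : Type*) (Q : Type*) where
  /-- the counter `i` -/
  level : ℕ
  /-- the current colors of the transitions of the automaton -/
  color : Q × α → ℕ
  /-- the transitions that are left in the coloring graph -/
  graph : Set (Q × α)

open Classical in
/-- Give all transitions in `T` the color `i`. -/
noncomputable def recolor (c : Q × α → ℕ) (T : Set (Q × α)) (i : ℕ) : Q × α → ℕ :=
  fun t => if t ∈ T then i else c t

/-- The transitions of the graph `G` that have the least color in their strongly connected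
component of `G`, where this color has the same parity as `i`. -/
def leastOfParity (A : DPA α Q) (c : Q × α → ℕ) (G : Set (Q × α)) (i : ℕ) : Set (Q × α) :=
  {t ∈ G | c t % 2 = i % 2 ∧
    A.SameSCC G t.1 (A.next t) ∧
    ∀ s ∈ G, A.SameSCC G t.1 s.1 → A.SameSCC G t.1 (A.next s) → c t ≤ c s}

open Classical in
/-- One round of the streamlining process: the transient transitions get the color `i` and are
removed; then, if there are transitions of least color in their component with the parity of `i`,
these get the color `i` and are removed, and otherwise `i` is incremented. -/
noncomputable def streamliningStep (A : DPA α Q) (s : StreamliningState α Q) :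
    StreamliningState α Q :=
  let T := A.transient s.graph
  let c := recolor s.color T s.level
  let G := s.graph \ T
  let M := A.leastOfParity c G s.level
  ⟨if M.Nonempty then s.level else s.level + 1, recolor c M s.level, G \ M⟩

/-- The state of the streamlining process after `n` rounds. -/
noncomputable def streamliningStage (A : DPA α Q) : ℕ → StreamliningState α Q
  | 0 => ⟨0, A.color, Set.univ⟩
  | n + 1 => A.streamliningStep (A.streamliningStage n)

theorem streamliningStep_graph_subset (A : DPA α Q) (s : StreamliningState α Q) :
    (A.streamliningStep s).graph ⊆ s.graph :=
  fun _ h => h.1.1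

theorem exists_mem_leastOfParity (A : DPA α Q) (c : Q × α → ℕ) (G : Set (Q × α))
    (hG : G.Nonempty) (hT : A.transient G = ∅) (i : ℕ) :
    (A.leastOfParity c G i).Nonempty ∨ (A.leastOfParity c G (i + 1)).Nonempty := by
  obtain ⟨t, ht, hmin⟩ : ∃ t ∈ G, ∀ s ∈ G, c t ≤ c s := by
    obtain ⟨t, ht, h⟩ := (measure c).wf.has_min G hG
    exact ⟨t, ht, fun s hs => not_lt.1 (h s hs)⟩
  have hr : A.SameSCC G t.1 (A.next t) := by
    refine ⟨Relation.ReflTransGen.single ⟨t.2, ht, rfl⟩, ?_⟩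
    by_contra h
    have : t ∈ A.transient G := ⟨ht, h⟩
    rw [hT] at this
    exact this
  rcases (by omega : c t % 2 = i % 2 ∨ c t % 2 = (i + 1) % 2) with h | h
  · exact Or.inl ⟨t, ht, h, hr, fun s hs _ _ => hmin s hs⟩
  · exact Or.inr ⟨t, ht, h, hr, fun s hs _ _ => hmin s hs⟩

theorem streamliningStep_of_graph_eq (A : DPA α Q) (s : StreamliningState α Q)
    (h : (A.streamliningStep s).graph = s.graph) :
    A.transient s.graph = ∅ ∧ A.leastOfParity s.color s.graph s.level = ∅ ∧
      A.streamliningStep s = ⟨s.level + 1, s.color, s.graph⟩ := by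
  have hT : A.transient s.graph = ∅ := by
    rw [Set.eq_empty_iff_forall_notMem]
    intro t ht
    have h1 : t ∈ (A.streamliningStep s).graph := h ▸ ht.1
    exact h1.1.2 ht
  have hc : ∀ c : Q × α → ℕ, recolor c (∅ : Set (Q × α)) s.level = c := by
    intro c
    funext t
    simp [recolor]
  have hM : A.leastOfParity s.color s.graph s.level = ∅ := by
    rw [Set.eq_empty_iff_forall_notMem]
    intro t ht
    have h1 : t ∈ (A.streamliningStep s).graph := h ▸ ht.1
    have h2 := h1.2
    rw [hT, hc, Set.sdiff_empty] at h2
    exact h2 ht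
  refine ⟨hT, hM, ?_⟩
  unfold streamliningStep
  dsimp only
  rw [hT, hc, Set.sdiff_empty, hM, hc, Set.sdiff_empty, if_neg Set.not_nonempty_empty]

/-- The streamlining process terminates. -/
theorem streamlining_terminates [Finite α] [Finite Q] (A : DPA α Q) :
    ∃ n, (A.streamliningStage n).graph = ∅ := by
  suffices H : ∀ k n, (A.streamliningStage n).graph.ncard = k →
      ∃ m, (A.streamliningStage m).graph = ∅ from H _ 0 rfl
  intro k
  induction k using Nat.strong_induction_on with
  | _ k ih =>
    intro n hn
    have sub := fun m => A.streamliningStep_graph_subset (A.streamliningStage m)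
    by_cases h1 : (A.streamliningStage (n + 1)).graph = (A.streamliningStage n).graph
    · by_cases h2 : (A.streamliningStage (n + 2)).graph = (A.streamliningStage (n + 1)).graph
      · refine ⟨n, ?_⟩
        by_contra hne
        obtain ⟨hT, hM, hs⟩ := A.streamliningStep_of_graph_eq _ h1
        obtain ⟨-, hM', -⟩ := A.streamliningStep_of_graph_eq _ h2
        change A.streamliningStage (n + 1) = _ at hs
        rw [hs] at hM'
        rcases A.exists_mem_leastOfParity (A.streamliningStage n).color _
          (Set.nonempty_iff_ne_empty.2 hne) hT (A.streamliningStage n).level with h | h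
        · exact h.ne_empty hM
        · exact h.ne_empty hM'
      · refine ih _ ?_ (n + 2) rfl
        rw [← hn, ← h1]
        exact Set.ncard_lt_ncard ((sub (n + 1)).ssubset_of_ne h2) (Set.toFinite _)
    · refine ih _ ?_ (n + 1) rfl
      rw [← hn]
      exact Set.ncard_lt_ncard ((sub n).ssubset_of_ne h1) (Set.toFinite _)

open Classical in
/-- The streamlined version of an automaton: the colors are those at the end of the streamlining
process, that is, as soon as the coloring graph is empty. -/
noncomputable def streamline [Finite α] [Finite Q] (A : DPA α Q) : DPA α Q :=
  { A with color := (A.streamliningStage (Nat.find A.streamlining_terminates)).color }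

/-- An automaton is streamlined if it is the streamlined version of a structured one. -/
def IsStreamlined [Finite α] [Finite Q] (A : DPA α Q) : Prop :=
  ∃ B : DPA α Q, B.IsStructured ∧ A = B.streamline

/-- The co-Büchi automaton `𝒜ᵢ`. -/
def coBuchi (A : DPA α Q) (i : ℕ) : ParityAutomaton α Q where
  trans := {(q, x, p, d) | ∃ q' c, (q, x, q', c) ∈ A.toParityAutomaton.trans ∧
    ((p = q' ∧ d = 2 ∧ i ≤ c) ∨
     (p = q' ∧ d = 1 ∧ c < i) ∨
     (d = 1 ∧ A.StateEquiv q' p ∧ ∀ c', (q, x, p, c') ∉ A.toParityAutomaton.trans))}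
  init := {A.start}

end DPA

namespace NaturalColor

variable {α : Type*}

/-- The suffix language of `L` over the finite word `u`. -/
def suffixLanguage (L : Set (Stream' α)) (u : List α) : Set (Stream' α) :=
  {w | u ++ₛ w ∈ L}

/-- `u` is suffix language invariant for `L` after `v`. -/
def SuffixInvariant (L : Set (Stream' α)) (v u : List α) : Prop :=
  suffixLanguage L v = suffixLanguage L (v ++ u)

/-- The finite word `w₀ … w_{p 0} u₀ w_{p 0 + 1} … w_{p 1} u₁ … u_{k-1} w_{p (k-1) + 1} … w_{p k}`,
for `p 0 < p 1 < …`. -/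
def injectionPrefix (w : Stream' α) (p : ℕ → ℕ) (u : ℕ → List α) : ℕ → List α
  | 0 => w.take (p 0 + 1)
  | k + 1 => injectionPrefix w p u k ++ u k ++ (w.drop (p k + 1)).take (p (k + 1) - p k)

/-- `w'` is the result of a suffix language invariant injection of `u₀, u₁, …` into `w` at the
positions `p 0 < p 1 < …`. -/
def IsInjection (L : Set (Stream' α)) (w : Stream' α) (p : ℕ → ℕ) (u : ℕ → List α)
    (w' : Stream' α) : Prop :=
  (∀ k, ∃ v : Stream' α, w' = injectionPrefix w p u k ++ₛ v) ∧
    ∀ k, SuffixInvariant L (w.take (p k + 1)) (u k)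

/-- `w` is at home in color `i` for `L`. The infinite set of positions is given by its increasing
enumeration `p`. -/
def AtHome (L : Set (Stream' α)) (i : ℕ) (w : Stream' α) : Prop :=
  ∃ p : ℕ → ℕ, StrictMono p ∧ ∀ (u : ℕ → List α) (w' : Stream' α), IsInjection L w p u w' →
    (∃ j, ∃ _ : j < i, AtHome L j w') ∨
    (w ∈ L ∧ w' ∈ L ∧ Even i) ∨ (w ∉ L ∧ w' ∉ L ∧ Odd i)
termination_by i

/-- `c` is the natural color of `w` for `L`: the minimal color in which `w` is at home. -/
def IsNaturalColor (L : Set (Stream' α)) (w : Stream' α) (c : ℕ) : Prop :=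
  IsLeast {i | AtHome L i w} c

end NaturalColor

/-!
Write `q_m` for the state of `𝒜` after the first `m` letters of `w`. A run of `𝒜ᵢ` can jump to any
equivalent state at the price of the color `1`, so `𝒜ᵢ` accepts `w` if, and only if, for some `m`
and some `q` equivalent to `q_m`, the deterministic run from `q` on the rest of `w` only uses colors
at least `i` (`DPA.EventuallyAtLeast`, `DPA.mem_language_coBuchi`). The indices `i` with this
property form an initial segment `{0, …, c}`, and the accepting run of `𝒜_c` sees the color `c`
infinitely often, so `w` is in the language if, and only if, `c` is even. It remains to see that `c`
is the least color in which `w` is at home.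

* `w` is at home in `c`: since `𝒜_{c+1}` rejects `w` and there are finitely many states, the
  positions of an injection can be chosen so far apart that between two of them every run from an
  equivalent state sees a color at most `c`. A suffix language invariant injection preserves the
  equivalence class of the state at these positions, so `𝒜_{c+1}` also rejects every result `w'`
  (`DPA.exists_positions_not_eventuallyAtLeast`). Then either the last automaton that accepts `w'`
  has a smaller index, in which `w'` is at home by induction, or it is `𝒜_c`, and `w` and `w'` are
  both in the language or both outside of it, according to the parity of `c`.

* `w` is not at home in any `i < c`: in a streamlined automaton, every transition of color at least
  `i + 1` lies on a cycle with least color `i + 1` (`DPA.IsStreamlined.exists_color_eq`), because the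
  counter is raised from `i` to `i + 1` only when the least color in every remaining component has
  the parity of `i + 1`. Injecting such cycles into the accepting run of `𝒜_{i+1}` at any positions
  yields a word `w'` that `𝒜_{i+1}` accepts and that is in the language if, and only if, `i + 1` is
  even (`DPA.EventuallyAtLeast.exists_injection`). By induction `w'` is not at home in any color
  smaller than `i`, so these positions do not witness that `w` is at home in `i`.
-/

namespace DPA

open ParityAutomaton NaturalColor

variable {α Q : Type*}

/-! ### Runs of deterministic automata -/

/-- The state reached from `q` by reading the finite word `l`. -/
def run (A : DPA α Q) (q : Q) (l : List α) : Q :=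
  l.foldl (fun q x => A.next (q, x)) q

/-- The colors of the transitions taken from `q` while reading the finite word `l`. -/
def colors (A : DPA α Q) : Q → List α → List ℕ
  | _, [] => []
  | q, x :: l => A.color (q, x) :: A.colors (A.next (q, x)) l

/-- The color of transition number `n` of the run from `q` on the infinite word `w`. -/
def colorAt (A : DPA α Q) (q : Q) (w : Stream' α) (n : ℕ) : ℕ :=
  A.color (A.run q (w.take n), w.get n)

@[simp] theorem run_nil (A : DPA α Q) (q : Q) : A.run q [] = q := rfl

theorem run_append (A : DPA α Q) (q : Q) (l l' : List α) :
    A.run q (l ++ l') = A.run (A.run q l) l' :=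
  List.foldl_append

theorem run_take_succ (A : DPA α Q) (q : Q) (w : Stream' α) (n : ℕ) :
    A.run q (w.take (n + 1)) = A.next (A.run q (w.take n), w.get n) := by
  rw [Stream'.take_succ', run_append]
  rfl

theorem colors_append (A : DPA α Q) (q : Q) (l l' : List α) :
    A.colors q (l ++ l') = A.colors q l ++ A.colors (A.run q l) l' := by
  induction l generalizing q with
  | nil => rfl
  | cons x l ih => simp only [List.cons_append, colors, ih]; rfl

theorem _root_.Stream'.take_length_add_append (l : List α) (v : Stream' α) (n : ℕ) :
    (l ++ₛ v).take (l.length + n) = l ++ v.take n := by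
  induction l with
  | nil => simp
  | cons x l ih =>
    rw [List.length_cons, Nat.add_right_comm, Stream'.cons_append_stream, Stream'.take_succ_cons, ih]
    rfl

theorem _root_.Stream'.take_length_append (l : List α) (v : Stream' α) :
    (l ++ₛ v).take l.length = l := by
  simpa using Stream'.take_length_add_append l v 0

theorem _root_.Stream'.get_length_add_append (l : List α) (v : Stream' α) (n : ℕ) :
    (l ++ₛ v).get (l.length + n) = v.get n := by
  rw [← Stream'.get_drop, Stream'.drop_append_stream]

theorem colorAt_append (A : DPA α Q) (q : Q) (l : List α) (v : Stream' α) (n : ℕ) :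
    A.colorAt q (l ++ₛ v) (l.length + n) = A.colorAt (A.run q l) v n := by
  rw [colorAt, Stream'.take_length_add_append, Stream'.get_length_add_append, run_append, colorAt]

theorem colorAt_drop (A : DPA α Q) (q : Q) (w : Stream' α) (m n : ℕ) :
    A.colorAt (A.run q (w.take m)) (w.drop m) n = A.colorAt q w (m + n) := by
  have h := A.colorAt_append q (w.take m) (w.drop m) n
  rw [Stream'.append_take_drop, Stream'.length_take] at h
  exact h.symm

theorem mem_colors_take (A : DPA α Q) (q : Q) (w : Stream' α) (n c : ℕ) :
    c ∈ A.colors q (w.take n) ↔ ∃ m < n, A.colorAt q w m = c := by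
  induction n with
  | zero => simp [colors]
  | succ n ih =>
    rw [Stream'.take_succ', colors_append, List.mem_append, ih]
    simp only [colors, List.mem_singleton, Nat.lt_succ_iff_lt_or_eq, or_and_right, exists_or,
      exists_eq_left]
    rw [colorAt, eq_comm (a := c)]

theorem mem_colors_iff (A : DPA α Q) (q : Q) (l : List α) (v : Stream' α) (c : ℕ) :
    c ∈ A.colors q l ↔ ∃ m < l.length, A.colorAt q (l ++ₛ v) m = c := by
  rw [← mem_colors_take, Stream'.take_length_append]

/-! ### The accepted language and state equivalence -/

theorem mem_language_withStart (A : DPA α Q) (q : Q) (w : Stream' α) :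
    w ∈ (A.withStart q).language ↔ ∃ c, IsDominating (A.colorAt q w) c ∧ Even c := by
  constructor
  · rintro ⟨π, ρ, ⟨h0, h⟩, hc⟩
    have hπ : ∀ n, π n = A.run q (w.take n) := by
      intro n
      induction n with
      | zero => exact h0
      | succ n ih => rw [run_take_succ, ← ih]; exact (h n).1
    have hρ : ρ = A.colorAt q w := by
      funext n
      rw [colorAt, ← hπ]
      exact (h n).2
    rwa [hρ] at hc
  · intro hc
    exact ⟨fun n => A.run q (w.take n), A.colorAt q w,
      ⟨rfl, fun n => ⟨A.run_take_succ q w n, rfl⟩⟩, hc⟩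

theorem infinite_setOf_add_iff (P : ℕ → Prop) (m : ℕ) :
    {n | P (m + n)}.Infinite ↔ {n | P n}.Infinite := by
  rw [← Nat.frequently_atTop_iff_infinite, ← Nat.frequently_atTop_iff_infinite]
  conv_rhs => rw [← Filter.map_add_atTop_eq_nat m, Filter.frequently_map]
  simp only [add_comm]

theorem isDominating_add_iff (ρ : ℕ → ℕ) (m c : ℕ) :
    IsDominating (fun n => ρ (m + n)) c ↔ IsDominating ρ c := by
  unfold IsDominating
  simp only [fun c => infinite_setOf_add_iff (fun n => ρ n = c) m]

theorem append_mem_language_withStart (A : DPA α Q) (q : Q) (l : List α) (v : Stream' α) :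
    l ++ₛ v ∈ (A.withStart q).language ↔ v ∈ (A.withStart (A.run q l)).language := by
  simp only [mem_language_withStart, ← isDominating_add_iff (A.colorAt q _) l.length,
    colorAt_append]

theorem StateEquiv.symm {A : DPA α Q} {q q' : Q} (h : A.StateEquiv q q') : A.StateEquiv q' q :=
  Eq.symm h

theorem StateEquiv.trans {A : DPA α Q} {q q' q'' : Q} (h : A.StateEquiv q q')
    (h' : A.StateEquiv q' q'') : A.StateEquiv q q'' :=
  Eq.trans h h'

theorem StateEquiv.run {A : DPA α Q} {q q' : Q} (h : A.StateEquiv q q') (l : List α) :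
    A.StateEquiv (A.run q l) (A.run q' l) := by
  refine Set.ext fun v => ?_
  rw [← append_mem_language_withStart, ← append_mem_language_withStart, h]

theorem StateEquiv.next {A : DPA α Q} {q q' : Q} (h : A.StateEquiv q q') (x : α) :
    A.StateEquiv (A.next (q, x)) (A.next (q', x)) :=
  h.run [x]

theorem suffixInvariant_iff (A : DPA α Q) (l u : List α) :
    SuffixInvariant A.language l u ↔
      A.StateEquiv (A.run A.start l) (A.run A.start (l ++ u)) := by
  have h : ∀ l, suffixLanguage A.language l =
      (A.withStart (A.run A.start l)).language := fun l =>
    Set.ext fun v => A.append_mem_language_withStart A.start l v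
  rw [NaturalColor.SuffixInvariant, h, h, StateEquiv]

/-! ### Colors in streamlined automata -/

theorem streamliningStep_color_of_notMem (A : DPA α Q) (s : StreamliningState α Q) {t : Q × α}
    (ht : t ∉ s.graph) : (A.streamliningStep s).color t = s.color t := by
  have h1 : t ∉ A.transient s.graph := fun h => ht h.1
  have h2 : t ∉ A.leastOfParity (recolor s.color (A.transient s.graph) s.level)
      (s.graph \ A.transient s.graph) s.level := fun h => ht h.1.1
  simp only [streamliningStep, recolor] at h2 ⊢
  rw [if_neg h2, if_neg h1]

theorem streamliningStep_color_of_removed (A : DPA α Q) (s : StreamliningState α Q) {t : Q × α}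
    (ht : t ∈ s.graph) (ht' : t ∉ (A.streamliningStep s).graph) :
    (A.streamliningStep s).color t = s.level := by
  simp only [streamliningStep, Set.mem_sdiff, not_and, not_not] at ht' ⊢
  by_cases h2 : t ∈ A.leastOfParity (recolor s.color (A.transient s.graph) s.level)
      (s.graph \ A.transient s.graph) s.level
  · rw [recolor, if_pos h2]
  · rw [recolor, if_neg h2, recolor, if_pos]
    by_contra h1
    exact h2 (ht' ⟨ht, h1⟩)

theorem level_le_streamliningStep (A : DPA α Q) (s : StreamliningState α Q) :
    s.level ≤ (A.streamliningStep s).level ∧ (A.streamliningStep s).level ≤ s.level + 1 := by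
  simp only [streamliningStep]
  split <;> simp

theorem streamliningStage_level_mono (A : DPA α Q) :
    Monotone fun n => (A.streamliningStage n).level :=
  monotone_nat_of_le_succ fun _ => (A.level_le_streamliningStep _).1

/-- A transition that has been removed keeps the color it got at its removal. -/
theorem streamliningStage_color_of_notMem (A : DPA α Q) {m n : ℕ} (hmn : m ≤ n) {t : Q × α}
    (ht : t ∉ (A.streamliningStage m).graph) :
    t ∉ (A.streamliningStage n).graph ∧
      (A.streamliningStage n).color t = (A.streamliningStage m).color t := by
  induction n, hmn using Nat.le_induction with
  | base => exact ⟨ht, rfl⟩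
  | succ n _ ih =>
    exact ⟨fun h => ih.1 (A.streamliningStep_graph_subset _ h),
      (A.streamliningStep_color_of_notMem _ ih.1).trans ih.2⟩

theorem streamliningStage_color_le (A : DPA α Q) (n : ℕ) {t : Q × α}
    (ht : t ∉ (A.streamliningStage n).graph) :
    (A.streamliningStage n).color t ≤ (A.streamliningStage n).level := by
  induction n with
  | zero => exact absurd (Set.mem_univ t) ht
  | succ n ih =>
    refine le_trans ?_ (A.level_le_streamliningStep _).1
    by_cases h : t ∈ (A.streamliningStage n).graph
    · exact (A.streamliningStep_color_of_removed _ h ht).le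
    · exact (A.streamliningStep_color_of_notMem _ h).trans_le (ih h)

/-- A transition that is left in the coloring graph gets at least the current level as its
color. -/
theorem level_le_streamliningStage_color (A : DPA α Q) {m n : ℕ} {t : Q × α}
    (hm : t ∈ (A.streamliningStage m).graph) (hn : t ∉ (A.streamliningStage n).graph) :
    (A.streamliningStage m).level ≤ (A.streamliningStage n).color t := by
  induction n with
  | zero => exact absurd (Set.mem_univ t) hn
  | succ n ih =>
    by_cases h : t ∈ (A.streamliningStage n).graph
    · refine le_trans ?_ (A.streamliningStep_color_of_removed _ h hn).ge
      refine A.streamliningStage_level_mono (not_lt.1 fun hlt => ?_)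
      exact (A.streamliningStage_color_of_notMem hlt hn).1 hm
    · exact (ih h).trans (A.streamliningStep_color_of_notMem _ h).ge

theorem Reachable.sdiff_transient {A : DPA α Q} {G : Set (Q × α)} {q q' : Q}
    (h : A.Reachable G q q') (h' : A.Reachable G q' q) :
    A.Reachable (G \ A.transient G) q q' := by
  induction h with
  | refl => exact Relation.ReflTransGen.refl
  | @tail r s hr hs ih =>
    obtain ⟨x, hx, rfl⟩ := hs
    refine (ih (Relation.ReflTransGen.head ⟨x, hx, rfl⟩ h')).tail ⟨x, ⟨hx, fun ht => ht.2 ?_⟩, rfl⟩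
    exact Relation.ReflTransGen.trans h' hr

theorem transient_sdiff_transient (A : DPA α Q) (G : Set (Q × α)) :
    A.transient (G \ A.transient G) = ∅ := by
  refine Set.eq_empty_iff_forall_notMem.2 fun t ht => ?_
  obtain ⟨⟨htG, hnt⟩, ht⟩ := ht
  have h : A.Reachable G (A.next t) t.1 := by
    by_contra h
    exact hnt ⟨htG, h⟩
  exact ht (h.sdiff_transient (Relation.ReflTransGen.single ⟨t.2, htG, rfl⟩))

theorem exists_streamliningStage_level_eq_succ (A : DPA α Q) {n i : ℕ}
    (h : i + 1 ≤ (A.streamliningStage n).level) :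
    ∃ m < n, (A.streamliningStage m).level = i ∧ (A.streamliningStage (m + 1)).level = i + 1 := by
  induction n with
  | zero => exact absurd h (Nat.not_succ_le_zero i)
  | succ n ih =>
    by_cases h' : i + 1 ≤ (A.streamliningStage n).level
    · obtain ⟨m, hm, h⟩ := ih h'
      exact ⟨m, hm.trans (Nat.lt_succ_self n), h⟩
    · have := (A.level_le_streamliningStep (A.streamliningStage n)).2
      change (A.streamliningStage (n + 1)).level ≤ _ at this
      exact ⟨n, Nat.lt_succ_self n, by omega, by omega⟩

theorem recolor_empty (c : Q × α → ℕ) (i : ℕ) : recolor c ∅ i = c := by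
  funext t
  simp [recolor]

/-- When the level is raised to `i + 1`, every transition `t` left in the coloring graph has in its
strongly connected component a transition that is removed in the next round: the least color of
that component does not have the parity of `i`. -/
theorem exists_removed_of_level_eq_succ (A : DPA α Q) {m i : ℕ}
    (h : (A.streamliningStage m).level = i) (h' : (A.streamliningStage (m + 1)).level = i + 1)
    {t : Q × α} (ht : t ∈ (A.streamliningStage (m + 1)).graph) :
    ∃ s ∈ (A.streamliningStage (m + 1)).graph, s ∉ (A.streamliningStage (m + 2)).graph ∧
      A.Reachable (A.streamliningStage (m + 1)).graph (A.next t) s.1 ∧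
      A.Reachable (A.streamliningStage (m + 1)).graph (A.next s) t.1 := by
  set S := A.streamliningStage m with hS
  set S' := A.streamliningStage (m + 1) with hS'
  have hstep : S' = A.streamliningStep S := rfl
  have hM : A.leastOfParity (recolor S.color (A.transient S.graph) S.level)
      (S.graph \ A.transient S.graph) S.level = ∅ := by
    by_contra hne
    rw [hstep, streamliningStep] at h'
    dsimp only at h'
    rw [if_pos (Set.nonempty_iff_ne_empty.2 hne)] at h'
    omega
  have hG : S'.graph = S.graph \ A.transient S.graph := by
    rw [hstep, streamliningStep]
    dsimp only
    rw [hM, Set.sdiff_empty]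
  have hc : S'.color = recolor S.color (A.transient S.graph) S.level := by
    rw [hstep, streamliningStep]
    dsimp only
    rw [hM, recolor_empty]
  rw [← hG, ← hc, h] at hM
  have hT : A.transient S'.graph = ∅ := by rw [hG, transient_sdiff_transient]
  have hrefl : ∀ s ∈ S'.graph, A.SameSCC S'.graph s.1 (A.next s) := by
    refine fun s hs => ⟨Relation.ReflTransGen.single ⟨s.2, hs, rfl⟩, ?_⟩
    by_contra hn
    have hs' : s ∈ A.transient S'.graph := ⟨hs, hn⟩
    rwa [hT] at hs'
  obtain ⟨s, ⟨hs, hts, hts'⟩, hmin⟩ : ∃ s ∈ {s ∈ S'.graph | A.SameSCC S'.graph t.1 s.1 ∧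
      A.SameSCC S'.graph t.1 (A.next s)}, ∀ r ∈ {s ∈ S'.graph | A.SameSCC S'.graph t.1 s.1 ∧
      A.SameSCC S'.graph t.1 (A.next s)}, S'.color s ≤ S'.color r := by
    obtain ⟨s, hs, hs'⟩ := (measure S'.color).wf.has_min
      {s ∈ S'.graph | A.SameSCC S'.graph t.1 s.1 ∧ A.SameSCC S'.graph t.1 (A.next s)}
      ⟨t, ht, ⟨Relation.ReflTransGen.refl, Relation.ReflTransGen.refl⟩, hrefl t ht⟩
    exact ⟨s, hs, fun r hr => not_lt.1 (hs' r hr)⟩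
  have hmin' : ∀ r ∈ S'.graph, A.SameSCC S'.graph s.1 r.1 → A.SameSCC S'.graph s.1 (A.next r) →
      S'.color s ≤ S'.color r := fun r hr h1 h2 => hmin r ⟨hr,
    ⟨hts.1.trans h1.1, h1.2.trans hts.2⟩, ⟨hts.1.trans h2.1, h2.2.trans hts.2⟩⟩
  refine ⟨s, hs, fun hs2 => ?_, (hrefl t ht).2.trans hts.1, hts'.2⟩
  have hs3 : s ∉ A.leastOfParity S'.color S'.graph S'.level := by
    have h2 := hs2.2
    change s ∉ A.leastOfParity (recolor S'.color (A.transient S'.graph) S'.level)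
      (S'.graph \ A.transient S'.graph) S'.level at h2
    rwa [hT, recolor_empty, Set.sdiff_empty] at h2
  have hs4 : s ∉ A.leastOfParity S'.color S'.graph i := hM ▸ Set.notMem_empty s
  rw [h'] at hs3
  rcases (by omega : S'.color s % 2 = i % 2 ∨ S'.color s % 2 = (i + 1) % 2) with hp | hp
  · exact hs4 ⟨hs, hp, hrefl s hs, hmin'⟩
  · exact hs3 ⟨hs, hp, hrefl s hs, hmin'⟩

/-- In a streamlined automaton, every transition of color at least `i + 1` lies, in the graph of
the transitions of color at least `i + 1`, on a cycle through a transition of color exactly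
`i + 1`. -/
theorem IsStreamlined.exists_color_eq [Finite α] [Finite Q] {A : DPA α Q} (hA : A.IsStreamlined)
    {i : ℕ} {t : Q × α} (ht : i + 1 ≤ A.color t) :
    ∃ s, A.color s = i + 1 ∧ A.Reachable {t | i + 1 ≤ A.color t} (A.next t) s.1 ∧
      A.Reachable {t | i + 1 ≤ A.color t} (A.next s) t.1 := by
  classical
  obtain ⟨B, -, rfl⟩ := hA
  obtain ⟨N, hN, hcolor⟩ : ∃ N, (B.streamliningStage N).graph = ∅ ∧
      B.streamline.color = (B.streamliningStage N).color :=
    ⟨_, Nat.find_spec B.streamlining_terminates, rfl⟩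
  have hN' : ∀ t, t ∉ (B.streamliningStage N).graph := fun t => hN ▸ Set.notMem_empty t
  rw [hcolor] at ht ⊢
  obtain ⟨m, hmN, hm, hm'⟩ := B.exists_streamliningStage_level_eq_succ
    (ht.trans (B.streamliningStage_color_le N (hN' t)))
  have hG : {t | i + 1 ≤ (B.streamliningStage N).color t} =
      (B.streamliningStage (m + 1)).graph := by
    refine Set.ext fun t => ⟨fun h => ?_, fun h => ?_⟩
    · by_contra hn
      rw [Set.mem_ofPred_eq, (B.streamliningStage_color_of_notMem hmN hn).2] at h
      by_cases hn' : t ∈ (B.streamliningStage m).graph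
      · have := B.streamliningStep_color_of_removed _ hn' hn
        have h' : i + 1 ≤ (B.streamliningStage m).level := h.trans this.le
        omega
      · rw [(B.streamliningStage_color_of_notMem (Nat.le_add_right m 1) hn').2] at h
        have := B.streamliningStage_color_le m hn'
        omega
    · exact hm'.ge.trans (B.level_le_streamliningStage_color h (hN' t))
  obtain ⟨s, hs, hs', h1, h2⟩ := B.exists_removed_of_level_eq_succ hm hm' (hG.le ht)
  have hmN' : m + 2 ≤ N := by
    by_contra hlt
    obtain rfl : N = m + 1 := by omega
    exact hN' s hs
  refine ⟨s, ?_, hG ▸ h1, hG ▸ h2⟩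
  rw [(B.streamliningStage_color_of_notMem hmN' hs').2]
  exact (B.streamliningStep_color_of_removed _ hs hs').trans hm'

/-! ### Acceptance by the co-Büchi automata -/

/-- From some position on, a state that is equivalent to the current state of the run of `A` on `w`
has a run on the remaining word that only uses colors at least `i`. -/
def EventuallyAtLeast (A : DPA α Q) (i : ℕ) (w : Stream' α) : Prop :=
  ∃ m q, A.StateEquiv q (A.run A.start (w.take m)) ∧ ∀ n, i ≤ A.colorAt q (w.drop m) n

theorem run_take_add (A : DPA α Q) (q : Q) (w : Stream' α) (m n : ℕ) :
    A.run q (w.take (m + n)) = A.run (A.run q (w.take m)) ((w.drop m).take n) := by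
  have h := Stream'.take_length_add_append (w.take m) (w.drop m) n
  rw [Stream'.append_take_drop, Stream'.length_take] at h
  rw [h, run_append]

/-- The witnessing position of `EventuallyAtLeast` can be moved to the right. -/
theorem EventuallyAtLeast.exists_at {A : DPA α Q} {i : ℕ} {w : Stream' α}
    (h : A.EventuallyAtLeast i w) :
    ∃ m, ∀ m' ≥ m, ∃ q, A.StateEquiv q (A.run A.start (w.take m')) ∧
      ∀ n, i ≤ A.colorAt q (w.drop m') n := by
  obtain ⟨m, q, hq, hc⟩ := h
  refine ⟨m, fun m' hm => ?_⟩
  obtain ⟨k, rfl⟩ := Nat.exists_eq_add_of_le hm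
  refine ⟨A.run q ((w.drop m).take k), ?_, fun n => ?_⟩
  · rw [run_take_add]
    exact hq.run _
  · rw [← Stream'.drop_drop, colorAt_drop]
    exact hc _

theorem EventuallyAtLeast.mono {A : DPA α Q} {i j : ℕ} {w : Stream' α}
    (h : A.EventuallyAtLeast j w) (hij : i ≤ j) : A.EventuallyAtLeast i w := by
  obtain ⟨m, q, hq, hc⟩ := h
  exact ⟨m, q, hq, fun n => hij.trans (hc n)⟩

theorem mem_language_coBuchi (A : DPA α Q) (i : ℕ) (w : Stream' α) :
    w ∈ (A.coBuchi i).language ↔ A.EventuallyAtLeast i w := by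
  classical
  constructor
  · rintro ⟨π, ρ, ⟨h0, htr⟩, c, hdom, hev⟩
    have hequiv : ∀ n, A.StateEquiv (π n) (A.run A.start (w.take n)) := by
      intro n
      induction n with
      | zero => rw [show π 0 = A.start from h0]; rfl
      | succ n ih =>
        rw [run_take_succ]
        refine StateEquiv.trans ?_ (ih.next _)
        obtain ⟨q', c', ⟨rfl, rfl⟩, ⟨h, -, -⟩ | ⟨h, -, -⟩ | ⟨-, h, -⟩⟩ := htr n
        · rw [h]; rfl
        · rw [h]; rfl
        · exact h.symm
    have hρ : ∀ n, ρ n = 1 ∨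
        ρ n = 2 ∧ π (n + 1) = A.next (π n, w.get n) ∧ i ≤ A.color (π n, w.get n) := by
      intro n
      obtain ⟨q', c', ⟨rfl, rfl⟩, ⟨h, h2, h3⟩ | ⟨-, h, -⟩ | ⟨h, -, -⟩⟩ := htr n
      · exact Or.inr ⟨h2, h, h3⟩
      · exact Or.inl h
      · exact Or.inl h
    have hfin : {n | ρ n = 1}.Finite := by
      by_contra hinf
      have hle : c ≤ 1 := hdom.2 hinf
      obtain ⟨n, hn : ρ n = c⟩ := Set.Infinite.nonempty hdom.1
      have hpos : 1 ≤ c := by rcases hρ n with h | h <;> omega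
      obtain rfl : c = 1 := le_antisymm hle hpos
      exact absurd hev (by decide)
    obtain ⟨b, hb⟩ := hfin.bddAbove
    have hgood : ∀ n, π (b + 1 + n + 1) = A.next (π (b + 1 + n), w.get (b + 1 + n)) ∧
        i ≤ A.color (π (b + 1 + n), w.get (b + 1 + n)) := by
      intro n
      refine ((hρ (b + 1 + n)).resolve_left fun h => ?_).2
      have : b + 1 + n ≤ b := hb h
      omega
    have hrun : ∀ n, π (b + 1 + n) = A.run (π (b + 1)) ((w.drop (b + 1)).take n) := by
      intro n
      induction n with
      | zero => rfl
      | succ n ih => rw [run_take_succ, ← ih, Stream'.get_drop, ← (hgood n).1]; rfl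
    refine ⟨b + 1, π (b + 1), hequiv _, fun n => ?_⟩
    rw [colorAt, ← hrun, Stream'.get_drop]
    exact (hgood n).2
  · intro h
    obtain ⟨m, h⟩ := h.exists_at
    -- The jump to `q` is taken with the last letter before position `m + 1`.
    obtain ⟨q, hq, hc⟩ := h (m + 1) (Nat.le_succ m)
    set π : ℕ → Q := fun n =>
      if n ≤ m then A.run A.start (w.take n) else A.run q ((w.drop (m + 1)).take (n - (m + 1)))
      with hπ
    have hπ0 : π 0 = A.start := by simp [hπ]
    have hπ' : ∀ n, π (m + 1 + n) = A.run q ((w.drop (m + 1)).take n) := by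
      intro n
      simp only [hπ]
      rw [if_neg (by omega), Nat.add_sub_cancel_left]
    have hequiv : ∀ n, A.StateEquiv (π n) (A.run A.start (w.take n)) := by
      intro n
      by_cases hn : n ≤ m
      · simp only [hπ]
        rw [if_pos hn]
        rfl
      · obtain ⟨k, rfl⟩ := Nat.exists_eq_add_of_le (Nat.lt_of_not_le hn)
        rw [hπ', run_take_add]
        exact hq.run _
    set ρ : ℕ → ℕ := fun n =>
      if π (n + 1) = A.next (π n, w.get n) ∧ i ≤ A.color (π n, w.get n) then 2 else 1 with hρ
    have hρ' : ∀ n, ρ (m + 1 + n) = 2 := by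
      intro n
      simp only [hρ]
      rw [if_pos]
      rw [show m + 1 + n + 1 = m + 1 + (n + 1) from rfl, hπ', hπ', run_take_succ,
        Stream'.get_drop]
      exact ⟨rfl, Stream'.get_drop n (m + 1) w ▸ hc n⟩
    refine ⟨π, ρ, ⟨hπ0, fun n => ⟨A.next (π n, w.get n), A.color (π n, w.get n), ⟨rfl, rfl⟩, ?_⟩⟩,
      2, ?_, even_two⟩
    · by_cases h1 : π (n + 1) = A.next (π n, w.get n)
      · by_cases h2 : i ≤ A.color (π n, w.get n)
        · exact Or.inl ⟨h1, if_pos ⟨h1, h2⟩, h2⟩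
        · exact Or.inr (Or.inl ⟨h1, if_neg fun h => h2 h.2, not_le.1 h2⟩)
      · refine Or.inr (Or.inr ⟨if_neg fun h => h1 h.1, ?_, fun c' h => h1 h.1⟩)
        refine StateEquiv.trans ((hequiv n).next _) ?_
        rw [← run_take_succ]
        exact (hequiv (n + 1)).symm
    · rw [← isDominating_add_iff ρ (m + 1)]
      simp only [hρ']
      refine ⟨?_, fun c hcinf => ?_⟩
      · simpa using Set.infinite_univ
      · obtain ⟨n, hn⟩ := Set.Infinite.nonempty hcinf
        exact le_of_eq hn

/-- The indices `i` for which `𝒜ᵢ` accepts a given word form an initial segment. -/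
theorem exists_eventuallyAtLeast_iff_le [Finite α] [Finite Q] (A : DPA α Q) (w : Stream' α) :
    ∃ c, ∀ i, A.EventuallyAtLeast i w ↔ i ≤ c := by
  classical
  obtain ⟨b, hb⟩ := (Set.finite_range A.color).bddAbove
  have hex : ∃ i, ¬ A.EventuallyAtLeast i w := by
    refine ⟨b + 1, fun ⟨m, q, _, hc⟩ => ?_⟩
    exact Nat.not_succ_le_self b ((hc 0).trans (hb ⟨_, rfl⟩))
  have h0 : Nat.find hex ≠ 0 := by
    intro h
    have := Nat.find_spec hex
    rw [h] at this
    exact this ⟨0, A.start, rfl, fun _ => Nat.zero_le _⟩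
  refine ⟨Nat.find hex - 1, fun i => ⟨fun h => ?_, fun h => ?_⟩⟩
  · by_contra hlt
    exact Nat.find_spec hex (h.mono (by omega))
  · exact not_not.1 (Nat.find_min hex (m := i) (by omega))

theorem mem_language_iff_even (A : DPA α Q) {m n : ℕ} {q : Q} {w : Stream' α}
    (hq : A.StateEquiv q (A.run A.start (w.take m)))
    (hdom : IsDominating (A.colorAt q (w.drop m)) n) : w ∈ A.language ↔ Even n := by
  have h := A.append_mem_language_withStart A.start (w.take m) (w.drop m)
  rw [Stream'.append_take_drop, ← show _ = _ from hq,
    A.mem_language_withStart q] at h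
  refine h.trans ⟨fun ⟨c, hc, hev⟩ => ?_, fun hev => ⟨n, hdom, hev⟩⟩
  rwa [IsLeast.unique hdom hc]

theorem isDominating_of_infinite {ρ : ℕ → ℕ} {n : ℕ} (hle : ∀ k, n ≤ ρ k)
    (hinf : {k | ρ k = n}.Infinite) : IsDominating ρ n := by
  refine ⟨hinf, fun c hc => ?_⟩
  obtain ⟨k, hk⟩ := Set.Infinite.nonempty hc
  exact (hle k).trans (le_of_eq hk)

/-- If `𝒜ₙ` is the last automaton that accepts `w`, its accepting run sees the color `n` infinitely
often, so the parity of `n` decides whether `w` is in the language. -/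
theorem EventuallyAtLeast.mem_language_iff_even {A : DPA α Q} {n : ℕ} {w : Stream' α}
    (h : A.EventuallyAtLeast n w) (h' : ¬ A.EventuallyAtLeast (n + 1) w) :
    w ∈ A.language ↔ Even n := by
  obtain ⟨m, q, hq, hc⟩ := h
  refine A.mem_language_iff_even hq (isDominating_of_infinite hc ?_)
  by_contra hfin
  obtain ⟨b, hb⟩ := (Set.not_infinite.1 hfin).bddAbove
  refine h' ⟨m + (b + 1), A.run q ((w.drop m).take (b + 1)), ?_, fun k => ?_⟩
  · rw [A.run_take_add A.start]
    exact hq.run _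
  · rw [← Stream'.drop_drop, colorAt_drop]
    refine lt_of_le_of_ne (hc _) fun heq => ?_
    have : b + 1 + k ≤ b := hb heq.symm
    omega

/-! ### Injections -/

theorem le_length_injectionPrefix (w : Stream' α) {p : ℕ → ℕ} (hp : StrictMono p)
    (u : ℕ → List α) (k : ℕ) : k + 1 ≤ (injectionPrefix w p u k).length := by
  induction k with
  | zero => simp [injectionPrefix]
  | succ k ih =>
    have := hp (Nat.lt_add_one k)
    simp only [injectionPrefix, List.length_append, Stream'.length_take]
    omega

theorem injectionPrefix_prefix (w : Stream' α) (p : ℕ → ℕ) (u : ℕ → List α) {k k' : ℕ}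
    (h : k ≤ k') : injectionPrefix w p u k <+: injectionPrefix w p u k' := by
  induction k', h using Nat.le_induction with
  | base => exact List.prefix_rfl
  | succ k' _ ih =>
    rw [injectionPrefix, List.append_assoc]
    exact ih.trans (List.prefix_append _ _)

theorem exists_isInjection (L : Set (Stream' α)) (w : Stream' α) {p : ℕ → ℕ} (hp : StrictMono p)
    {u : ℕ → List α} (hu : ∀ k, SuffixInvariant L (w.take (p k + 1)) (u k)) :
    ∃ w', IsInjection L w p u w' := by
  have hlen := le_length_injectionPrefix w hp u
  let w' : Stream' α := fun n => (injectionPrefix w p u n)[n]'(hlen n)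
  refine ⟨w', fun k => ⟨w'.drop (injectionPrefix w p u k).length, ?_⟩, hu⟩
  suffices h : w'.take (injectionPrefix w p u k).length = injectionPrefix w p u k by
    conv_lhs => rw [← Stream'.append_take_drop (injectionPrefix w p u k).length w', h]
  refine List.ext_getElem (Stream'.length_take _ _) fun n h1 h2 => ?_
  have h3 : (w'.take (injectionPrefix w p u k).length)[n]? = some (w' n) :=
    Stream'.getElem?_take h2
  have h4 : (w'.take (injectionPrefix w p u k).length)[n] = w' n := by
    rw [List.getElem?_eq_getElem h1] at h3
    exact Option.some.inj h3
  rw [h4]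
  rcases le_total k n with hkn | hkn
  · exact ((injectionPrefix_prefix w p u hkn).getElem h2).symm
  · exact (injectionPrefix_prefix w p u hkn).getElem (hlen n)

theorem take_succ_position (w : Stream' α) {p : ℕ → ℕ} (hp : StrictMono p) (k : ℕ) :
    w.take (p (k + 1) + 1) =
      w.take (p k + 1) ++ (w.drop (p k + 1)).take (p (k + 1) - p k) := by
  have h := Stream'.take_length_add_append (w.take (p k + 1)) (w.drop (p k + 1)) (p (k + 1) - p k)
  rw [Stream'.append_take_drop, Stream'.length_take] at h
  rw [← h]
  have := hp (Nat.lt_add_one k)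
  congr 1
  omega

/-- A suffix language invariant injection does not change the equivalence class of the state
reached at the positions of the injection. -/
theorem stateEquiv_run_injectionPrefix (A : DPA α Q) {w : Stream' α} {p : ℕ → ℕ}
    (hp : StrictMono p) {u : ℕ → List α}
    (hu : ∀ k, SuffixInvariant A.language (w.take (p k + 1)) (u k)) (k : ℕ) :
    A.StateEquiv (A.run A.start (injectionPrefix w p u k)) (A.run A.start (w.take (p k + 1))) ∧
      A.StateEquiv (A.run A.start (injectionPrefix w p u k ++ u k))
        (A.run A.start (w.take (p k + 1))) := by
  have step : ∀ k, A.StateEquiv (A.run A.start (injectionPrefix w p u k))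
      (A.run A.start (w.take (p k + 1))) →
      A.StateEquiv (A.run A.start (injectionPrefix w p u k ++ u k))
        (A.run A.start (w.take (p k + 1))) := by
    intro k h
    have h' := (A.suffixInvariant_iff _ _).1 (hu k)
    rw [run_append] at h' ⊢
    exact (h.run _).trans h'.symm
  have main : A.StateEquiv (A.run A.start (injectionPrefix w p u k))
      (A.run A.start (w.take (p k + 1))) := by
    induction k with
    | zero => rfl
    | succ k ih =>
      rw [injectionPrefix, A.run_append _ (_ ++ _), take_succ_position w hp,
        A.run_append _ (w.take _)]
      exact (step k ih).run _
  exact ⟨main, step k main⟩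

/-! ### The upper bound on the natural color -/

/-- There is a bound on how long runs on `w` from states equivalent to the current one can avoid
colors at most `n`, if `𝒜ₙ₊₁` rejects `w`. -/
theorem exists_bound_of_not_eventuallyAtLeast [Finite Q] (A : DPA α Q) {n : ℕ} {w : Stream' α}
    (h : ¬ A.EventuallyAtLeast (n + 1) w) (m : ℕ) :
    ∃ b, ∀ q, A.StateEquiv q (A.run A.start (w.take m)) →
      ∃ k < b, A.colorAt q (w.drop m) k ≤ n := by
  have hex : ∀ q, ∃ k, A.StateEquiv q (A.run A.start (w.take m)) →
      A.colorAt q (w.drop m) k ≤ n := by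
    intro q
    by_contra! hq
    exact h ⟨m, q, (hq 0).1, fun k => (hq k).2⟩
  choose f hf using hex
  obtain ⟨b, hb⟩ := (Set.finite_range f).bddAbove
  exact ⟨b + 1, fun q hq => ⟨f q, Nat.lt_succ_of_le (hb ⟨q, rfl⟩), hf q hq⟩⟩

/-- If `𝒜ₙ₊₁` rejects `w`, the positions can be chosen so far apart that `𝒜ₙ₊₁` rejects every
result of an injection: between two consecutive positions, each run from a state in the right
equivalence class sees a color at most `n`. -/
theorem exists_positions_not_eventuallyAtLeast [Finite Q] (A : DPA α Q) {n : ℕ} {w : Stream' α}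
    (h : ¬ A.EventuallyAtLeast (n + 1) w) :
    ∃ p : ℕ → ℕ, StrictMono p ∧ ∀ u w', IsInjection A.language w p u w' →
      ¬ A.EventuallyAtLeast (n + 1) w' := by
  choose b hb using A.exists_bound_of_not_eventuallyAtLeast h
  let p : ℕ → ℕ := fun k => Nat.rec 0 (fun _ x => x + 1 + b (x + 1)) k
  have hpsucc : ∀ k, p (k + 1) = p k + 1 + b (p k + 1) := fun _ => rfl
  have hp : StrictMono p := strictMono_nat_of_lt_succ fun k => by
    have := hpsucc k
    omega
  refine ⟨p, hp, fun u w' ⟨hw', hu⟩ hacc => ?_⟩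
  obtain ⟨m, hacc⟩ := hacc.exists_at
  set l := injectionPrefix w p u m ++ u m with hl
  set s := (w.drop (p m + 1)).take (p (m + 1) - p m) with hs
  obtain ⟨v, hv⟩ := hw' (m + 1)
  replace hv : w' = l ++ₛ (s ++ₛ v) := by
    rw [hv, injectionPrefix, Stream'.append_append_stream]
  have hlen : m ≤ l.length := by
    have := le_length_injectionPrefix w hp u m
    rw [hl, List.length_append]
    omega
  obtain ⟨q, hq, hc⟩ := hacc l.length hlen
  rw [hv, Stream'.take_length_append] at hq
  rw [hv, Stream'.drop_append_stream] at hc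
  obtain ⟨k, hk, hkn⟩ := hb (p m + 1) q (hq.trans (A.stateEquiv_run_injectionPrefix hp hu m).2)
  have hmem : A.colorAt q (w.drop (p m + 1)) k ∈ A.colors q s := by
    rw [hs, mem_colors_take]
    exact ⟨k, by have := hpsucc m; omega, rfl⟩
  obtain ⟨k', -, hk'⟩ := (A.mem_colors_iff q s v _).1 hmem
  have := hc k'
  omega

/-- A word is at home in the index of the last co-Büchi automaton that accepts it. -/
theorem atHome_of_not_eventuallyAtLeast [Finite α] [Finite Q] (A : DPA α Q) (n : ℕ) :
    ∀ w, A.EventuallyAtLeast n w → ¬ A.EventuallyAtLeast (n + 1) w →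
      AtHome A.language n w := by
  induction n using Nat.strong_induction_on with
  | _ n ih =>
    intro w h h'
    obtain ⟨p, hp, hinj⟩ := A.exists_positions_not_eventuallyAtLeast h'
    rw [AtHome]
    refine ⟨p, hp, fun u w' hw' => ?_⟩
    obtain ⟨c, hc⟩ := A.exists_eventuallyAtLeast_iff_le w'
    have hcn : ¬ n + 1 ≤ c := fun hle => hinj u w' hw' ((hc _).2 hle)
    rcases (by omega : c < n ∨ c = n) with hlt | rfl
    · exact Or.inl ⟨c, hlt, ih c hlt w' ((hc c).2 le_rfl)
        fun hacc => Nat.not_succ_le_self c ((hc _).1 hacc)⟩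
    · have e := h.mem_language_iff_even h'
      have e' := ((hc c).2 le_rfl).mem_language_iff_even (hinj u w' hw')
      rcases Nat.even_or_odd c with hev | hodd
      · exact Or.inr (Or.inl ⟨e.2 hev, e'.2 hev, hev⟩)
      · have hnev := Nat.not_even_iff_odd.2 hodd
        exact Or.inr (Or.inr ⟨fun hw => hnev (e.1 hw), fun hw => hnev (e'.1 hw), hodd⟩)

/-! ### The lower bound on the natural color -/

theorem Reachable.exists_run {A : DPA α Q} {i : ℕ} {q q' : Q}
    (h : A.Reachable {t | i ≤ A.color t} q q') :
    ∃ l, A.run q l = q' ∧ ∀ c ∈ A.colors q l, i ≤ c := by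
  induction h with
  | refl => exact ⟨[], rfl, by simp [colors]⟩
  | tail _ hs ih =>
    obtain ⟨x, hx, rfl⟩ := hs
    obtain ⟨l, rfl, hl⟩ := ih
    refine ⟨l ++ [x], by rw [run_append]; rfl, fun c hc => ?_⟩
    rw [colors_append, List.mem_append] at hc
    rcases hc with hc | hc
    · exact hl c hc
    · rw [List.mem_singleton.1 hc]
      exact hx

/-- A loop in a streamlined automaton with least color `i + 1`. -/
theorem IsStreamlined.exists_loop [Finite α] [Finite Q] {A : DPA α Q} (hA : A.IsStreamlined)
    {i : ℕ} {q : Q} {x : α} (h : i + 1 ≤ A.color (q, x)) :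
    ∃ l, A.run q l = q ∧ (∀ c ∈ A.colors q l, i + 1 ≤ c) ∧ i + 1 ∈ A.colors q l := by
  obtain ⟨s, hs, h1, h2⟩ := hA.exists_color_eq h
  obtain ⟨l1, hl1, hc1⟩ := h1.exists_run
  obtain ⟨l2, hl2, hc2⟩ := h2.exists_run
  have hrun : A.run q (x :: l1) = s.1 := hl1
  have hcol : A.colors q (x :: l1 ++ s.2 :: l2) =
      A.color (q, x) :: A.colors (A.next (q, x)) l1 ++
        A.color s :: A.colors (A.next s) l2 := by
    rw [colors_append, hrun]
    rfl
  refine ⟨x :: l1 ++ s.2 :: l2, ?_, ?_, ?_⟩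
  · rw [run_append, hrun]
    exact hl2
  · intro c hc
    rw [hcol, List.mem_append, List.mem_cons, List.mem_cons] at hc
    rcases hc with (rfl | hc) | (rfl | hc)
    · exact h
    · exact hc1 c hc
    · exact hs.ge
    · exact hc2 c hc
  · rw [hcol, hs]
    simp

/-- If `𝒜ᵢ₊₁` accepts `w`, then at any given positions one can inject loops with least color `i + 1`
into the eventually deterministic part of an accepting run. The resulting word is still accepted by
`𝒜ᵢ₊₁`, and its membership in the language is decided by the parity of `i + 1`. -/
theorem EventuallyAtLeast.exists_injection [Finite α] [Finite Q] {A : DPA α Q}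
    (hA : A.IsStreamlined) {i : ℕ} {w : Stream' α} (h : A.EventuallyAtLeast (i + 1) w)
    {p : ℕ → ℕ} (hp : StrictMono p) :
    ∃ u w', IsInjection A.language w p u w' ∧ A.EventuallyAtLeast (i + 1) w' ∧
      (w' ∈ A.language ↔ Even (i + 1)) := by
  classical
  obtain ⟨m, h⟩ := h.exists_at
  obtain ⟨q, hq, hc⟩ := h (p m + 1) ((hp.le_apply).trans (Nat.le_succ _))
  -- the state of the run from `q` at position number `m + k` of the injection
  let r : ℕ → Q := fun k => A.run q ((w.drop (p m + 1)).take (p (m + k) - p m))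
  have hmono : ∀ k, p m ≤ p (m + k) := fun k => hp.monotone (Nat.le_add_right m k)
  have hequiv : ∀ k, A.StateEquiv (r k) (A.run A.start (w.take (p (m + k) + 1))) := by
    intro k
    have := hmono k
    rw [show p (m + k) + 1 = p m + 1 + (p (m + k) - p m) by omega, run_take_add]
    exact hq.run _
  have hloop : ∀ k, ∃ l, A.run (r k) l = r k ∧ (∀ c ∈ A.colors (r k) l, i + 1 ≤ c) ∧
      i + 1 ∈ A.colors (r k) l := fun k => hA.exists_loop (hc _)
  choose l hlrun hlge hlmem using hloop
  let u : ℕ → List α := fun k => if m ≤ k then l (k - m) else []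
  have hum : ∀ k, u (m + k) = l k := by
    intro k
    simp only [u]
    rw [if_pos (Nat.le_add_right m k), Nat.add_sub_cancel_left]
  have hu : ∀ k, SuffixInvariant A.language (w.take (p k + 1)) (u k) := by
    intro k
    rw [suffixInvariant_iff, run_append]
    by_cases hk : m ≤ k
    · obtain ⟨k, rfl⟩ := Nat.exists_eq_add_of_le hk
      rw [hum]
      have h1 := (hequiv k).run (l k)
      rw [hlrun] at h1
      exact (hequiv k).symm.trans h1
    · simp only [u]
      rw [if_neg hk]
      rfl
  obtain ⟨w', hw'⟩ := exists_isInjection A.language w hp hu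
  -- the injected word after position number `m` of the injection
  obtain ⟨v, hv⟩ := hw'.1 m
  have htail : ∀ k, ∃ e v', v = e ++ₛ v' ∧ k ≤ e.length ∧
      injectionPrefix w p u (m + k) = injectionPrefix w p u m ++ e ∧
      A.run q e = r k ∧ ∀ c ∈ A.colors q e, i + 1 ≤ c := by
    intro k
    obtain ⟨v', hv'⟩ := hw'.1 (m + k)
    suffices hs : ∃ e, k ≤ e.length ∧
        injectionPrefix w p u (m + k) = injectionPrefix w p u m ++ e ∧
        A.run q e = r k ∧ ∀ c ∈ A.colors q e, i + 1 ≤ c by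
      obtain ⟨e, h1, h2, h3⟩ := hs
      refine ⟨e, v', ?_, h1, h2, h3⟩
      rw [h2, hv, Stream'.append_append_stream] at hv'
      rw [← Stream'.drop_append_stream (injectionPrefix w p u m) v, hv',
        Stream'.drop_append_stream]
    clear hv' v'
    induction k with
    | zero => exact ⟨[], le_rfl, by simp, by simp [r], by simp [colors]⟩
    | succ k ih =>
      obtain ⟨e, h1, h2, h3, h4⟩ := ih
      have hlt := hp (Nat.lt_add_one (m + k))
      have hle := hmono k
      set s := (w.drop (p (m + k) + 1)).take (p (m + k + 1) - p (m + k)) with hs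
      have hs' : s = ((w.drop (p m + 1)).drop (p (m + k) - p m)).take
          (p (m + k + 1) - p (m + k)) := by
        rw [hs, Stream'.drop_drop]
        congr 2
        omega
      refine ⟨e ++ l k ++ s, ?_, ?_, ?_, ?_⟩
      · rw [List.length_append, List.length_append, hs, Stream'.length_take]
        omega
      · rw [← add_assoc, injectionPrefix, h2, hum]
        simp only [List.append_assoc, hs]
      · rw [run_append, run_append, h3, hlrun, hs', ← run_take_add]
        simp only [r]
        rw [← add_assoc]
        congr 2
        omega
      · intro c hcm
        rw [colors_append, colors_append, run_append, h3, hlrun] at hcm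
        rcases List.mem_append.1 hcm with hcm | hcm
        · rcases List.mem_append.1 hcm with hcm | hcm
          · exact h4 c hcm
          · exact hlge k c hcm
        · rw [hs', mem_colors_take] at hcm
          obtain ⟨j, -, rfl⟩ := hcm
          rw [colorAt_drop]
          exact hc _
  have hqv : A.StateEquiv q (A.run A.start (w'.take (injectionPrefix w p u m).length)) := by
    rw [hv, Stream'.take_length_append]
    exact hq.trans (A.stateEquiv_run_injectionPrefix hp hu m).1.symm
  have hge : ∀ n, i + 1 ≤ A.colorAt q v n := by
    intro n
    obtain ⟨e, v', rfl, h1, -, -, h4⟩ := htail (n + 1)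
    exact h4 _ ((A.mem_colors_iff q e v' _).2 ⟨n, h1, rfl⟩)
  have hinf : {n | A.colorAt q v n = i + 1}.Infinite := by
    refine Set.infinite_of_forall_exists_gt fun k => ?_
    obtain ⟨e, v', h0, h1, h2, h3, -⟩ := htail (k + 1)
    obtain ⟨v'', hv''⟩ := hw'.1 (m + (k + 1) + 1)
    have h5 : v = e ++ₛ (l (k + 1) ++ₛ
        ((w.drop (p (m + (k + 1)) + 1)).take (p (m + (k + 1) + 1) - p (m + (k + 1))) ++ₛ v'')) := by
      rw [injectionPrefix, h2, hum, hv] at hv''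
      simp only [Stream'.append_append_stream] at hv''
      rw [← Stream'.drop_append_stream (injectionPrefix w p u m) v, hv'',
        Stream'.drop_append_stream]
    obtain ⟨j, -, hj⟩ := (A.mem_colors_iff _ _ _ _).1 (hlmem (k + 1))
    refine ⟨e.length + j, ?_, by omega⟩
    rw [Set.mem_ofPred_eq, h5, colorAt_append, h3]
    exact hj
  have hdrop : w'.drop (injectionPrefix w p u m).length = v := by
    rw [hv, Stream'.drop_append_stream]
  exact ⟨u, w', hw', ⟨_, q, hqv, hdrop ▸ hge⟩,
    A.mem_language_iff_even hqv (hdrop ▸ isDominating_of_infinite hge hinf)⟩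

/-- If `𝒜ᵢ₊₁` accepts `w`, then `w` is not at home in color `i`: at the given positions, a word can
be injected whose result is not at home in a smaller color by induction, and whose membership in
the language contradicts the parity of `i`. -/
theorem not_atHome_of_eventuallyAtLeast [Finite α] [Finite Q] {A : DPA α Q}
    (hA : A.IsStreamlined) (i : ℕ) :
    ∀ w, A.EventuallyAtLeast (i + 1) w → ¬ AtHome A.language i w := by
  induction i using Nat.strong_induction_on with
  | _ i ih =>
    intro w h hhome
    rw [AtHome] at hhome
    obtain ⟨p, hp, hhome⟩ := hhome
    obtain ⟨u, w', hinj, hacc, hw'⟩ := h.exists_injection hA hp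
    rw [Nat.even_add_one] at hw'
    rcases hhome u w' hinj with ⟨j, hj, hhome⟩ | ⟨-, hmem, hev⟩ | ⟨-, hmem, hodd⟩
    · exact ih j hj w' (hacc.mono (by omega)) hhome
    · exact hw'.1 hmem hev
    · exact hmem (hw'.2 (Nat.not_even_iff_odd.2 hodd))

end DPA

theorem mainTheorem1 {α Q : Type*} [Finite α] [Finite Q] (A : DPA α Q) (hA : A.IsStreamlined)
    (w : Stream' α) :
    ∃ c : ℕ, NaturalColor.IsNaturalColor A.language w c ∧
      ∀ i : ℕ, w ∈ (A.coBuchi i).language ↔ i ≤ c := by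
  obtain ⟨c, hc⟩ := A.exists_eventuallyAtLeast_iff_le w
  refine ⟨c, ⟨?_, fun i hi => ?_⟩, fun i => (A.mem_language_coBuchi i w).trans (hc i)⟩
  · exact A.atHome_of_not_eventuallyAtLeast c w ((hc c).2 le_rfl)
      fun h => Nat.not_succ_le_self c ((hc _).1 h)
  · by_contra hlt
    exact DPA.not_atHome_of_eventuallyAtLeast hA i w ((hc _).2 (not_le.1 hlt)) hi
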